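/- Let $K\in\mathbb R$ and $N\in(1,\infty)$. For $\kappa\in\mathbb R$ let $s_\kappa(\theta)=\frac{1}{\sqrt\kappa}\sin(\sqrt\kappa\,\theta)$ if $\kappa>0$, $s_0(\theta)=\theta$, and $s_\kappa(\theta)=\frac{1}{\sqrt{-\kappa}}\sinh(\sqrt{-\kappa}\,\theta)$ if $\kappa<0$. Let $D_{K,N}=\pi/\sqrt{K/(N-1)}$ if $K>0$ and $D_{K,N}=+\infty$ otherwise. For $t\in[0,1]$ and $\theta\ge 0$ let $\sigma^{(t)}_{K,N-1}(\theta)=s_{K/(N-1)}(t\theta)/s_{K/(N-1)}(\theta)$ if $\theta<D_{K,N}$ (read as $t$ when $\theta=0$) and $\sigma^{(t)}_{K,N-1}(\theta)=+\infty$ if $\theta\ge D_{K,N}$. A non-negative locally integrable function $h$ on $\mathbb R$ is called an ${\rm MCP}(K,N)$ density if $$h(tx_1+(1-t)x_0)\ \ge\ \sigma^{(1-t)}_{K,N-1}(|x_1-x_0|)^{N-1}\,h(x_0)\qquad\text{for all }x_0,x_1\in\operatorname{supp}h,\ t\in[0,1],$$ where $\operatorname{supp}h$ is the support of the measure $h(x)\,dx$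 and $\infty\cdot 0=0$. The Poincaré constant of $h$ is $$\lambda[h]=\inf\left\{\frac{\int_{\mathbb R}|f'|^2h\,dx}{\int_{\mathbb R}f^2h\,dx}\ :\ f:\mathbb R\to\mathbb R\text{ locally Lipschitz},\ \int_{\mathbb R}f h\,dx=0,\ 0<\int_{\mathbb R}f^2h\,dx<\infty\right\}\in[0,\infty]$$ (with $\inf\emptyset=\infty$, and where $fh$ is required to be integrable). For $0<D'<\infty$ with $D'\le D_{K,N}$, the model density is $h_{K,N,D'}(x)=s_{K/(N-1)}(D'-x)^{N-1}$ for $x\in[0,D'/2]$, $h_{K,N,D'}(x)=s_{K/(N-1)}(x)^{N-1}$ for $x\in[D'/2,D']$, and $h_{K,N,D'}(x)=0$ for $x\notin[0,D']$. Let $D\in(0,\infty)$, and let $h$ be an ${\rm MCP}(K,N)$ density with $\operatorname{diam}(\operatorname{supp}h)\le D$. Then $$\lambda[h]\ \ge\ \Lambda_{K,N,D}:=\begin{cases}\lambda[h_{K,N,D}]&\text{if }K\le 0,\\[2pt] \displaystyle\inf_{D'\in(0,\min(D,D_{K,N})]}\lambda[h_{K,N,D'}]&\text{if }K>0.\end{cases}$$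 The bound is sharp: each $h_{K,N,D'}$ with $D'\in(0,\min(D,D_{K,N})]$ is itself an ${\rm MCP}(K,N)$ density with support $[0,D']$; $\Lambda_{K,N,D}$ is the infimum of $\lambda[h]$ over all ${\rm MCP}(K,N)$ densities $h$ with $\operatorname{diam}(\operatorname{supp}h)\le D$; and if $K\le 0$ this infimum is attained. -/

import Mathlib

open MeasureTheory Set
open scoped ENNReal

namespace MCP

noncomputable section

/-- The function `s_κ`: `sin (√κ θ) / √κ`, `θ`, or `sinh (√(-κ) θ) / √(-κ)`, according to the
sign of `κ`. It is only used for `θ ≥ 0` (and `θ ≤ π / √κ` if `κ > 0`). -/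
def sFun (κ θ : ℝ) : ℝ :=
  if 0 < κ then (1 / Real.sqrt κ) * Real.sin (Real.sqrt κ * θ)
  else if κ = 0 then θ
  else (1 / Real.sqrt (-κ)) * Real.sinh (Real.sqrt (-κ) * θ)

/-- The Bonnet–Myers diameter bound `D_{K,N} ∈ (0, ∞]`. -/
def bonnetMyersDiam (K N : ℝ) : ℝ≥0∞ :=
  if 0 < K then ENNReal.ofReal (Real.pi / Real.sqrt (K / (N - 1))) else ⊤

/-- The distortion coefficient `σ^{(t)}_{K,N-1}(θ) ∈ [0, ∞]`, for `t ∈ [0,1]` and `θ ≥ 0`. The value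
at `θ = 0`, where the quotient below is not defined, is the usual continuous extension `t`. -/
def sigmaCoeff (K N t θ : ℝ) : ℝ≥0∞ :=
  if bonnetMyersDiam K N ≤ ENNReal.ofReal θ then ⊤
  else if θ = 0 then ENNReal.ofReal t
  else ENNReal.ofReal (sFun (K / (N - 1)) (t * θ) / sFun (K / (N - 1)) θ)

/-- The measure `h 𝓛¹` on the real line with (non-negative) Lebesgue density `h`. -/
def densityMeasure (h : ℝ → ℝ) : Measure ℝ :=
  volume.withDensity (fun x => ENNReal.ofReal (h x))

/-- `supp h`, the topological support of the measure `h 𝓛¹`. -/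
def supp (h : ℝ → ℝ) : Set ℝ := (densityMeasure h).support

/-- One-dimensional `MCP(K,N)` densities. The inequality is one in `[0, ∞]`, with `∞ · 0 = 0`. -/
structure IsMCPDensity (K N : ℝ) (h : ℝ → ℝ) : Prop where
  nonneg : ∀ x, 0 ≤ h x
  locallyIntegrable : LocallyIntegrable h volume
  contraction : ∀ x₀ ∈ supp h, ∀ x₁ ∈ supp h, ∀ t ∈ Icc (0 : ℝ) 1,
    sigmaCoeff K N (1 - t) |x₁ - x₀| ^ (N - 1) * ENNReal.ofReal (h x₀)
      ≤ ENNReal.ofReal (h (t * x₁ + (1 - t) * x₀))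

/-- The test functions of the Poincaré constant `λ[h]`: the locally Lipschitz `f : ℝ → ℝ` with
`∫ f h dx = 0` and `0 < ∫ f² h dx < ∞`. -/
structure IsPoincareTest (h f : ℝ → ℝ) : Prop where
  locallyLipschitz : LocallyLipschitz f
  integrable : Integrable f (densityMeasure h)
  mean_zero : ∫ x, f x ∂(densityMeasure h) = 0
  sq_pos : 0 < ∫⁻ x, ENNReal.ofReal (f x ^ 2) ∂(densityMeasure h)
  sq_lt_top : ∫⁻ x, ENNReal.ofReal (f x ^ 2) ∂(densityMeasure h) < ⊤

/-- The Poincaré constant `λ[h] ∈ [0, ∞]` of the space `(ℝ, |·|, h 𝓛¹)`: the infimum of the Rayleigh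
quotients `∫ |f'|² h dx / ∫ f² h dx`. A locally Lipschitz function is differentiable almost
everywhere, so the value that `deriv` takes at the other points does not matter. -/
def poincareConst (h : ℝ → ℝ) : ℝ≥0∞ :=
  ⨅ (f : ℝ → ℝ) (_ : IsPoincareTest h f),
    (∫⁻ x, ENNReal.ofReal (|deriv f x| ^ 2) ∂(densityMeasure h)) /
      (∫⁻ x, ENNReal.ofReal (f x ^ 2) ∂(densityMeasure h))

/-- The model density `h_{K,N,D}` on `[0, D]`, extended by zero to the real line. -/
def modelDensity (K N D x : ℝ) : ℝ :=
  if x ∈ Icc 0 (D / 2) then sFun (K / (N - 1)) (D - x) ^ (N - 1)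
  else if x ∈ Icc (D / 2) D then sFun (K / (N - 1)) x ^ (N - 1)
  else 0

/-- The `MCP(K,N)` densities whose support has diameter at most `D`. -/
def densitiesDiamLE (K N D : ℝ) : Set (ℝ → ℝ) :=
  {h | IsMCPDensity K N h ∧ Metric.ediam (supp h) ≤ ENNReal.ofReal D}

/-- The admissible diameters `(0, min(D, D_{K,N})]` of model densities. -/
def admissibleDiams (K N D : ℝ) : Set ℝ :=
  {D' | 0 < D' ∧ D' ≤ D ∧ ENNReal.ofReal D' ≤ bonnetMyersDiam K N}

/-- The lower bound: `λ[h_{K,N,D}]` if `K ≤ 0`, and the infimum of `λ[h_{K,N,D'}]` over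
`D' ∈ (0, min(D, D_{K,N})]` if `K > 0`. -/
def poincareBound (K N D : ℝ) : ℝ≥0∞ :=
  if K ≤ 0 then poincareConst (modelDensity K N D)
  else sInf ((fun D' => poincareConst (modelDensity K N D')) '' admissibleDiams K N D)

end

end MCP

/-! Let `h` have support `[a, b]` with midpoint `m`, and let `f` have mean zero. Replacing `f` by `f
- f m` does not decrease the second moment, so it suffices to bound the Rayleigh quotient on each
half of `[a, b]` for functions vanishing at `m`. On each half, contract towards the opposite
endpoint `e`: the MCP inequality makes `h(e ± u) / s(u)^(N-1)` nonincreasing in the distance `u`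
from `e` (`IsMCPDensity.antitoneOn_div`), and `s(u)^(N-1)` is exactly the model density on its outer
half. So `h` is the model weight times a nonincreasing factor.

By the layer cake formula (`lintegral_mul_le_of_antitoneOn`) that factor may be replaced by the
indicator of `(0, r)`. The inequality that remains comes from testing the model's Poincaré constant
with the odd extension of the function stopped at `r` (`poincareConst_modelDensity_mul_le`):
stopping keeps exactly the energy on `(0, r)` and only adds mass.

If `K ≤ 0`, a support shorter than `D` is first stretched to length `D`; the quotient stays monotone
because `s(cu)/s(u)` is nonincreasing for `c ≤ 1`. For `K > 0` this monotonicity is reversed, hence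
the infimum over `D'`. Sharpness holds because the models are MCP densities themselves
(`isMCPDensity_modelDensity`). -/

namespace MCP

/-! ### The functions `s_κ`. -/

theorem sFun_zero (κ : ℝ) : sFun κ 0 = 0 := by
  simp [sFun]

theorem continuous_sFun (κ : ℝ) : Continuous (sFun κ) := by
  unfold sFun
  split_ifs <;> fun_prop

/-- The addition formula `s(p+r) s(q+r) = s(r) s(p+q+r) + s(p) s(q)`. -/
theorem sFun_add_mul_sFun_add (κ p q r : ℝ) :
    sFun κ (p + r) * sFun κ (q + r) = sFun κ r * sFun κ (p + q + r) + sFun κ p * sFun κ q := by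
  unfold sFun
  split_ifs with h1 h2
  · simp only [mul_add, Real.sin_add, Real.cos_add]
    linear_combination (1 / √κ) ^ 2 * Real.sin (√κ * p) * Real.sin (√κ * q) *
      Real.sin_sq_add_cos_sq (√κ * r)
  · ring
  · simp only [mul_add, Real.sinh_add, Real.cosh_add]
    linear_combination (1 / √(-κ)) ^ 2 * Real.sinh (√(-κ) * p) * Real.sinh (√(-κ) * q) *
      Real.cosh_sq_sub_sinh_sq (√(-κ) * r)

theorem bonnetMyersDiam_of_nonpos {K : ℝ} (hK : K ≤ 0) (N : ℝ) : bonnetMyersDiam K N = ⊤ :=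
  if_neg hK.not_gt

theorem sFun_pos_of_nonpos {κ θ : ℝ} (hκ : κ ≤ 0) (hθ : 0 < θ) : 0 < sFun κ θ := by
  unfold sFun
  split_ifs with h1 h2
  · linarith
  · exact hθ
  · have : 0 < √(-κ) := Real.sqrt_pos.2 (by linarith [lt_of_le_of_ne hκ h2])
    have := Real.sinh_pos_iff.2 (mul_pos this hθ)
    positivity

theorem sFun_pos {K N θ : ℝ} (hN : 1 < N) (hθ : 0 < θ)
    (h : ENNReal.ofReal θ < bonnetMyersDiam K N) : 0 < sFun (K / (N - 1)) θ := by
  have hN' : 0 < N - 1 := by linarith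
  rcases le_or_gt K 0 with hK | hK
  · exact sFun_pos_of_nonpos (div_nonpos_of_nonpos_of_nonneg hK hN'.le) hθ
  · have hκ : 0 < K / (N - 1) := div_pos hK hN'
    have hs : 0 < √(K / (N - 1)) := Real.sqrt_pos.2 hκ
    rw [bonnetMyersDiam, if_pos hK, ENNReal.ofReal_lt_ofReal_iff (by positivity),
      lt_div_iff₀ hs] at h
    rw [sFun, if_pos hκ]
    have := Real.sin_pos_of_pos_of_lt_pi (mul_pos hs hθ) (by linarith)
    positivity

theorem sFun_eq_zero_of_eq {K N θ : ℝ} (hN : 1 < N) (hθ : 0 ≤ θ)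
    (h : ENNReal.ofReal θ = bonnetMyersDiam K N) : sFun (K / (N - 1)) θ = 0 := by
  have hN' : 0 < N - 1 := by linarith
  unfold bonnetMyersDiam at h
  split_ifs at h with hK
  · have hκ : 0 < K / (N - 1) := div_pos hK hN'
    have hs : 0 < √(K / (N - 1)) := Real.sqrt_pos.2 hκ
    rw [ENNReal.ofReal_eq_ofReal_iff hθ (by positivity)] at h
    rw [sFun, if_pos hκ, h, mul_div_cancel₀ _ hs.ne']
    simp
  · simp at h

theorem sFun_nonneg {K N θ : ℝ} (hN : 1 < N) (hθ : 0 ≤ θ)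
    (h : ENNReal.ofReal θ ≤ bonnetMyersDiam K N) : 0 ≤ sFun (K / (N - 1)) θ := by
  rcases h.lt_or_eq with h | h
  · rcases hθ.lt_or_eq with hθ | rfl
    · exact (sFun_pos hN hθ h).le
    · exact (sFun_zero _).ge
  · exact (sFun_eq_zero_of_eq hN hθ h).ge

/-- For `κ ≤ 0` and `0 < c ≤ 1` the quotient `s(c u) / s(u)` is nonincreasing in `u > 0`. -/
theorem sFun_mul_mul_sFun_le {κ c u v : ℝ} (hκ : κ ≤ 0) (hc : 0 < c) (hc1 : c ≤ 1) (hu : 0 < u)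
    (huv : u ≤ v) : sFun κ (c * v) * sFun κ u ≤ sFun κ (c * u) * sFun κ v := by
  rcases hκ.lt_or_eq with hκ | rfl
  swap
  · simp only [sFun, lt_irrefl, if_false, if_true]
    nlinarith
  have hs : 0 < √(-κ) := Real.sqrt_pos.2 (by linarith)
  -- The left side is the numerator of the derivative of `sinh (c x) / sinh x`. It vanishes at `0`,
  -- and its own derivative has the sign of `c ^ 2 - 1`.
  have hG : ∀ x : ℝ, 0 ≤ x → c * Real.cosh (c * x) * Real.sinh x
      - Real.sinh (c * x) * Real.cosh x ≤ 0 := by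
    have hd : ∀ x : ℝ, HasDerivAt (fun x => c * Real.cosh (c * x) * Real.sinh x
        - Real.sinh (c * x) * Real.cosh x)
        ((c ^ 2 - 1) * (Real.sinh (c * x) * Real.sinh x)) x := by
      intro x
      have h1 : HasDerivAt (fun x => c * x) c x := by simpa using (hasDerivAt_id x).const_mul c
      have := ((h1.cosh.const_mul c).mul (Real.hasDerivAt_sinh x)).sub
        (h1.sinh.mul (Real.hasDerivAt_cosh x))
      exact this.congr_deriv (by ring)
    have hanti : AntitoneOn (fun x => c * Real.cosh (c * x) * Real.sinh x
        - Real.sinh (c * x) * Real.cosh x) (Ici 0) := by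
      refine antitoneOn_of_deriv_nonpos (convex_Ici 0) (by fun_prop)
        (fun x _ => (hd x).differentiableAt.differentiableWithinAt) fun x hx => ?_
      rw [interior_Ici, mem_Ioi] at hx
      rw [(hd x).deriv]
      exact mul_nonpos_of_nonpos_of_nonneg (by nlinarith) (mul_nonneg
        (Real.sinh_nonneg_iff.2 (by positivity)) (Real.sinh_nonneg_iff.2 hx.le))
    intro x hx
    simpa using hanti (mem_Ici.2 le_rfl) hx hx
  have hanti : AntitoneOn (fun x => Real.sinh (c * x) / Real.sinh x) (Ioi 0) := by
    have hd : ∀ x : ℝ, 0 < x → HasDerivAt (fun x => Real.sinh (c * x) / Real.sinh x)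
        ((c * Real.cosh (c * x) * Real.sinh x - Real.sinh (c * x) * Real.cosh x)
          / Real.sinh x ^ 2) x := by
      intro x hx
      have h1 : HasDerivAt (fun x => c * x) c x := by simpa using (hasDerivAt_id x).const_mul c
      exact (h1.sinh.div (Real.hasDerivAt_sinh x) (Real.sinh_pos_iff.2 hx).ne').congr_deriv
        (by ring)
    refine antitoneOn_of_deriv_nonpos (convex_Ioi 0)
      (fun x hx => (hd x hx).continuousAt.continuousWithinAt)
      (fun x hx => ?_) fun x hx => ?_
    · rw [interior_Ioi, mem_Ioi] at hx
      exact (hd x hx).differentiableAt.differentiableWithinAt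
    · rw [interior_Ioi, mem_Ioi] at hx
      rw [(hd x hx).deriv]
      exact div_nonpos_of_nonpos_of_nonneg (hG x hx.le) (by positivity)
  have hv : 0 < v := hu.trans_le huv
  have := hanti (mem_Ioi.2 (mul_pos hs hu)) (mem_Ioi.2 (mul_pos hs hv)) (by gcongr)
  simp only at this
  rw [div_le_div_iff₀ (Real.sinh_pos_iff.2 (by positivity)) (Real.sinh_pos_iff.2 (by positivity))]
    at this
  simp only [sFun, hκ.not_gt, hκ.ne, if_false]
  rw [mul_left_comm _ c, mul_left_comm _ c]
  have h2 : 0 ≤ (1 / √(-κ)) ^ 2 := by positivity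
  nlinarith [mul_le_mul_of_nonneg_left this h2]

theorem sFun_neg (κ θ : ℝ) : sFun κ (-θ) = -sFun κ θ := by
  unfold sFun
  split_ifs <;> simp

/-! ### Model densities are MCP densities. -/

/-- The `(N-1)`-st root of the model density on `[0, D]`, as a function of `|x - D/2|`. -/
theorem modelDensity_eq {K N D : ℝ} (hD : 0 < D) (x : ℝ) :
    modelDensity K N D x =
      (Icc 0 D).indicator (fun x => sFun (K / (N - 1)) (D / 2 + |x - D / 2|) ^ (N - 1)) x := by
  unfold modelDensity indicator
  simp only [mem_Icc]
  by_cases h1 : 0 ≤ x ∧ x ≤ D / 2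
  · rw [if_pos h1, if_pos ⟨h1.1, by linarith⟩, abs_of_nonpos (by linarith)]
    congr 2
    ring
  · rw [if_neg h1]
    by_cases h2 : D / 2 ≤ x ∧ x ≤ D
    · rw [if_pos h2, if_pos ⟨by linarith, h2.2⟩, abs_of_nonneg (by linarith)]
      congr 2
      ring
    · rw [if_neg h2, if_neg]
      rintro ⟨h3, h4⟩
      rcases le_total x (D / 2) with h | h
      · exact h1 ⟨h3, h⟩
      · exact h2 ⟨h, h4⟩

theorem continuous_modelProfile (K D : ℝ) {N : ℝ} (hN : 1 < N) :
    Continuous fun x => sFun (K / (N - 1)) (D / 2 + |x - D / 2|) ^ (N - 1) := by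
  refine Continuous.rpow_const ((continuous_sFun _).comp (by fun_prop)) fun _ => Or.inr ?_
  linarith

theorem integrable_modelDensity {K N D : ℝ} (hN : 1 < N) (hD : 0 < D) :
    Integrable (modelDensity K N D) volume := by
  rw [funext (modelDensity_eq hD), integrable_indicator_iff measurableSet_Icc]
  exact (continuous_modelProfile K D hN).continuousOn.integrableOn_compact isCompact_Icc

theorem measurable_modelDensity {K N D : ℝ} (hN : 1 < N) (hD : 0 < D) :
    Measurable (modelDensity K N D) := by
  rw [funext (modelDensity_eq hD)]
  exact (continuous_modelProfile K D hN).measurable.indicator measurableSet_Icc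

theorem add_abs_sub_le {D x : ℝ} (hx : x ∈ Icc 0 D) : D / 2 + |x - D / 2| ≤ D := by
  have : |x - D / 2| ≤ D / 2 := abs_le.2 ⟨by linarith [hx.1], by linarith [hx.2]⟩
  linarith

theorem sFun_modelProfile_nonneg {K N D x : ℝ} (hN : 1 < N) (hD : 0 < D)
    (hDK : ENNReal.ofReal D ≤ bonnetMyersDiam K N) (hx : x ∈ Icc 0 D) :
    0 ≤ sFun (K / (N - 1)) (D / 2 + |x - D / 2|) :=
  sFun_nonneg hN (by positivity)
    ((ENNReal.ofReal_le_ofReal (add_abs_sub_le hx)).trans hDK)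

theorem modelDensity_nonneg {K N D : ℝ} (hN : 1 < N) (hD : 0 < D)
    (hDK : ENNReal.ofReal D ≤ bonnetMyersDiam K N) (x : ℝ) : 0 ≤ modelDensity K N D x := by
  rw [modelDensity_eq hD]
  exact indicator_nonneg
    (fun x hx => Real.rpow_nonneg (sFun_modelProfile_nonneg hN hD hDK hx) _) x

theorem aemeasurable_ofReal_of_locallyIntegrable {h : ℝ → ℝ} (hh : LocallyIntegrable h volume) :
    AEMeasurable (fun x => ENNReal.ofReal (h x)) volume :=
  hh.aestronglyMeasurable.aemeasurable.ennreal_ofReal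

theorem Icc_subset_supp {h : ℝ → ℝ} {a b : ℝ} (hab : a < b) (hh : LocallyIntegrable h volume)
    (hpos : ∀ x ∈ Ioo a b, 0 < h x) : Icc a b ⊆ supp h := by
  intro x hx
  rw [supp, Measure.mem_support_iff_forall]
  intro U hU
  rw [pos_iff_ne_zero]
  intro h0
  rw [densityMeasure, withDensity_apply_eq_zero' (aemeasurable_ofReal_of_locallyIntegrable hh)]
    at h0
  have hne : (interior U ∩ Ioo a b).Nonempty := by
    rw [← closure_Ioo hab.ne] at hx
    exact mem_closure_iff_nhds.1 hx _ (interior_mem_nhds.2 hU)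
  have := (isOpen_interior.inter isOpen_Ioo).measure_pos volume hne
  refine this.ne' (measure_mono_null ?_ h0)
  rintro y ⟨hy1, hy2⟩
  exact ⟨(ENNReal.ofReal_pos.2 (hpos y hy2)).ne', interior_subset hy1⟩

theorem supp_modelDensity {K N D : ℝ} (hN : 1 < N) (hD : 0 < D)
    (hDK : ENNReal.ofReal D ≤ bonnetMyersDiam K N) :
    supp (modelDensity K N D) = Icc 0 D := by
  refine Subset.antisymm ?_ ?_
  · refine Measure.support_subset_of_isClosed isClosed_Icc ?_
    rw [mem_ae_iff, densityMeasure, withDensity_apply _ measurableSet_Icc.compl,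
      setLIntegral_eq_zero_iff measurableSet_Icc.compl
        (measurable_modelDensity hN hD).ennreal_ofReal]
    refine Filter.Eventually.of_forall fun x hx => ?_
    rw [modelDensity_eq hD, indicator_of_notMem hx, ENNReal.ofReal_zero]
  · refine Icc_subset_supp hD (integrable_modelDensity hN hD).locallyIntegrable fun x hx => ?_
    rw [modelDensity_eq hD, indicator_of_mem (Ioo_subset_Icc_self hx)]
    have h1 : |x - D / 2| < D / 2 := abs_lt.2 ⟨by linarith [hx.1], by linarith [hx.2]⟩
    refine Real.rpow_pos_of_pos (sFun_pos hN (by positivity) (lt_of_lt_of_le ?_ hDK)) _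
    rw [ENNReal.ofReal_lt_ofReal_iff hD]
    linarith

/-- On each side of `D / 2` the profile is a single translate or reflection of `s`, and the addition
formula writes the difference of the two sides as a product of nonnegative values of `s`. This is
the `(N-1)`-st root of the MCP inequality for contraction to the right. -/
theorem modelProfile_contraction {K N D x₀ x x₁ : ℝ} (hN : 1 < N) (hD : 0 < D)
    (hDK : ENNReal.ofReal D ≤ bonnetMyersDiam K N) (h0 : 0 ≤ x₀) (hx : x₀ ≤ x) (hx' : x ≤ x₁)
    (h1 : x₁ ≤ D) :
    sFun (K / (N - 1)) (x₁ - x) * sFun (K / (N - 1)) (D / 2 + |x₀ - D / 2|)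
      ≤ sFun (K / (N - 1)) (x₁ - x₀) * sFun (K / (N - 1)) (D / 2 + |x - D / 2|) := by
  set κ := K / (N - 1)
  have hs : ∀ θ, 0 ≤ θ → θ ≤ D → 0 ≤ sFun κ θ := fun θ h h' =>
    sFun_nonneg hN h ((ENNReal.ofReal_le_ofReal h').trans hDK)
  have left : ∀ y z, x₀ ≤ y → y ≤ z → z ≤ x₁ → z ≤ D / 2 →
      sFun κ (x₁ - z) * sFun κ (D / 2 + |y - D / 2|)
        ≤ sFun κ (x₁ - y) * sFun κ (D / 2 + |z - D / 2|) := by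
    intro y z hy hyz hz hzD
    rw [abs_of_nonpos (by linarith), abs_of_nonpos (by linarith)]
    -- The gap between the two sides is exactly `s(D - x₁) s(z - y)`.
    have := sFun_add_mul_sFun_add κ (D - x₁) (z - y) (x₁ - z)
    have h2 := mul_nonneg (hs (D - x₁) (by linarith) (by linarith))
      (hs (z - y) (by linarith) (by linarith))
    ring_nf at this h2 ⊢
    linarith
  have right : ∀ y z, x₀ ≤ y → y ≤ z → z ≤ x₁ → D / 2 ≤ y →
      sFun κ (x₁ - z) * sFun κ (D / 2 + |y - D / 2|)
        ≤ sFun κ (x₁ - y) * sFun κ (D / 2 + |z - D / 2|) := by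
    intro y z hy hyz hz hyD
    rw [abs_of_nonneg (by linarith), abs_of_nonneg (by linarith)]
    -- Here the gap is `s(x₁) s(z - y)`, once oddness of `s` has removed the negative arguments.
    have := sFun_add_mul_sFun_add κ x₁ (y - z) (z - x₁)
    have h2 := mul_nonneg (hs x₁ (by linarith) (by linarith))
      (hs (z - y) (by linarith) (by linarith))
    rw [show y - z = -(z - y) by ring, show z - x₁ = -(x₁ - z) by ring, sFun_neg, sFun_neg,
      show -(z - y) + -(x₁ - z) = -(x₁ - y) by ring, sFun_neg] at this
    ring_nf at this h2 ⊢
    linarith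
  rcases le_total x (D / 2) with hxD | hxD
  · exact left x₀ x le_rfl hx hx' hxD
  rcases le_total (D / 2) x₀ with hxD' | hxD'
  · exact right x₀ x le_rfl hx hx' hxD'
  -- When `D / 2` lies between `x₀` and `x`, chain the two cases through `D / 2` and cancel `s(x₁ -
  -- D / 2)`, which is positive unless `x = x₁ = D / 2`.
  have h2 := left x₀ (D / 2) le_rfl hxD' (hxD.trans hx') le_rfl
  have h3 := right (D / 2) x hxD' hxD hx' le_rfl
  rcases eq_or_lt_of_le (hxD.trans hx') with h4 | h4
  · have : x = D / 2 := by linarith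
    subst this
    exact h2
  have h5 : 0 < sFun κ (x₁ - D / 2) := sFun_pos hN (by linarith)
    (lt_of_lt_of_le ((ENNReal.ofReal_lt_ofReal_iff hD).2 (by linarith)) hDK)
  have h6 := mul_le_mul_of_nonneg_left h2 (hs (x₁ - x) (by linarith) (by linarith))
  have h7 := mul_le_mul_of_nonneg_left h3 (hs (x₁ - x₀) (by linarith) (by linarith))
  refine le_of_mul_le_mul_left ?_ h5
  linarith

/-- Contraction to the left, by the symmetry `x ↦ D - x`. -/
theorem modelProfile_contraction' {K N D x₀ x x₁ : ℝ} (hN : 1 < N) (hD : 0 < D)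
    (hDK : ENNReal.ofReal D ≤ bonnetMyersDiam K N) (h1 : 0 ≤ x₁) (hx : x₁ ≤ x) (hx' : x ≤ x₀)
    (h0 : x₀ ≤ D) :
    sFun (K / (N - 1)) (x - x₁) * sFun (K / (N - 1)) (D / 2 + |x₀ - D / 2|)
      ≤ sFun (K / (N - 1)) (x₀ - x₁) * sFun (K / (N - 1)) (D / 2 + |x - D / 2|) := by
  have := modelProfile_contraction (x₀ := D - x₀) (x := D - x) (x₁ := D - x₁) hN hD hDK
    (by linarith) (by linarith) (by linarith) (by linarith)
  rwa [show D - x₁ - (D - x) = x - x₁ by ring, show D - x₁ - (D - x₀) = x₀ - x₁ by ring,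
    show D - x₀ - D / 2 = -(x₀ - D / 2) by ring, show D - x - D / 2 = -(x - D / 2) by ring,
    abs_neg, abs_neg] at this

theorem isMCPDensity_modelDensity {K N D : ℝ} (hN : 1 < N) (hD : 0 < D)
    (hDK : ENNReal.ofReal D ≤ bonnetMyersDiam K N) :
    IsMCPDensity K N (modelDensity K N D) where
  nonneg := modelDensity_nonneg hN hD hDK
  locallyIntegrable := (integrable_modelDensity hN hD).locallyIntegrable
  contraction := by
    intro x₀ h0 x₁ h1 t ht
    rw [supp_modelDensity hN hD hDK] at h0 h1
    have hN' : 0 < N - 1 := by linarith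
    have hx : t * x₁ + (1 - t) * x₀ ∈ Icc 0 D :=
      (convex_Icc 0 D) h1 h0 ht.1 (by linarith [ht.2]) (by ring)
    have hθ : |x₁ - x₀| ≤ D := abs_sub_le_of_nonneg_of_le h1.1 h1.2 h0.1 h0.2
    unfold sigmaCoeff
    split_ifs with hle heq
    -- An infinite coefficient forces `D` to be the Bonnet–Myers diameter and `x₀` to be an endpoint
    -- of `[0, D]`, where the density vanishes; the convention `∞ · 0 = 0` applies.
    · have hDθ : D ≤ |x₁ - x₀| :=
        (ENNReal.ofReal_le_ofReal_iff (abs_nonneg _)).1 (hDK.trans hle)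
      have hDD : ENNReal.ofReal D = bonnetMyersDiam K N :=
        le_antisymm hDK (hle.trans (ENNReal.ofReal_le_ofReal hθ))
      have hend : D / 2 + |x₀ - D / 2| = D := by
        rcases le_abs.1 hDθ with h | h
        · rw [abs_of_nonpos] <;> linarith [h0.1, h1.2]
        · rw [abs_of_nonneg] <;> linarith [h1.1, h0.2]
      rw [modelDensity_eq hD x₀, indicator_of_mem h0, hend, sFun_eq_zero_of_eq hN hD.le hDD,
        Real.zero_rpow hN'.ne']
      simp
    · have : x₁ = x₀ := by linarith [abs_eq_zero.1 heq]
      subst this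
      rw [show t * x₁ + (1 - t) * x₁ = x₁ by ring]
      refine mul_le_of_le_one_left (by positivity) (ENNReal.rpow_le_one ?_ hN'.le)
      exact ENNReal.ofReal_le_one.2 (by linarith [ht.1])
    · rw [not_le] at hle
      have hθ0 : 0 < |x₁ - x₀| := lt_of_le_of_ne (abs_nonneg _) (Ne.symm heq)
      have hpos := sFun_pos hN hθ0 hle
      have hnum : 0 ≤ sFun (K / (N - 1)) ((1 - t) * |x₁ - x₀|) := by
        refine sFun_nonneg hN (mul_nonneg (by linarith [ht.2]) hθ0.le)
          ((ENNReal.ofReal_le_ofReal ?_).trans hle.le)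
        nlinarith [ht.1]
      have hk0 := sFun_modelProfile_nonneg hN hD hDK h0
      rw [modelDensity_eq hD, modelDensity_eq hD, indicator_of_mem h0, indicator_of_mem hx,
        ENNReal.ofReal_rpow_of_nonneg (div_nonneg hnum hpos.le) hN'.le,
        ← ENNReal.ofReal_mul (Real.rpow_nonneg (div_nonneg hnum hpos.le) _),
        ← Real.mul_rpow (div_nonneg hnum hpos.le) hk0]
      refine ENNReal.ofReal_le_ofReal (Real.rpow_le_rpow
        (mul_nonneg (div_nonneg hnum hpos.le) hk0) ?_ hN'.le)
      rw [div_mul_eq_mul_div, div_le_iff₀' hpos]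
      rcases le_total x₀ x₁ with h | h
      · have := modelProfile_contraction (x₀ := x₀) (x := t * x₁ + (1 - t) * x₀) (x₁ := x₁)
          hN hD hDK h0.1 (by nlinarith [ht.1]) (by nlinarith [ht.2]) h1.2
        rwa [show x₁ - (t * x₁ + (1 - t) * x₀) = (1 - t) * |x₁ - x₀| by
          rw [abs_of_nonneg (by linarith)]; ring, ← abs_of_nonneg (sub_nonneg.2 h), abs_abs] at this
      · have := modelProfile_contraction' (x₀ := x₀) (x := t * x₁ + (1 - t) * x₀) (x₁ := x₁)
          hN hD hDK h1.1 (by nlinarith [ht.2]) (by nlinarith [ht.1]) h0.2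
        rwa [show t * x₁ + (1 - t) * x₀ - x₁ = (1 - t) * |x₁ - x₀| by
          rw [abs_of_nonpos (by linarith)]; ring, ← abs_of_nonneg (sub_nonneg.2 h),
          abs_sub_comm x₀ x₁] at this

/-! ### Weighted integrals and the layer cake argument. -/

theorem lintegral_densityMeasure {h : ℝ → ℝ} (hh : LocallyIntegrable h volume) (G : ℝ → ℝ≥0∞) :
    ∫⁻ x, G x ∂(densityMeasure h) = ∫⁻ x, G x * ENNReal.ofReal (h x) := by
  rw [densityMeasure, lintegral_withDensity_eq_lintegral_mul_non_measurable₀ _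
    (aemeasurable_ofReal_of_locallyIntegrable hh) (by simp)]
  simp only [Pi.mul_apply, mul_comm]

theorem lintegral_comp_abs_sub (H : ℝ → ℝ≥0∞) (c : ℝ) :
    ∫⁻ x, H |x - c| = 2 * ∫⁻ y in Ioi 0, H y := by
  rw [lintegral_sub_right_eq_self (fun x => H |x|) c,
    ← lintegral_add_compl _ (measurableSet_Ioi (a := (0 : ℝ))), two_mul]
  congr 1
  · exact setLIntegral_congr_fun measurableSet_Ioi fun x hx => by
      simp only [abs_of_pos (mem_Ioi.1 hx)]
  · rw [compl_Ioi, ← setLIntegral_congr (Iio_ae_eq_Iic (a := (0 : ℝ)) (μ := volume))]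
    have := (Measure.measurePreserving_neg (volume : Measure ℝ)).setLIntegral_comp_preimage_emb
      (MeasurableEquiv.neg ℝ).measurableEmbedding H (Ioi 0)
    rw [← this]
    simp only [neg_preimage, neg_Ioi, neg_zero]
    exact setLIntegral_congr_fun measurableSet_Iio fun x hx => by
      simp only [abs_of_neg (mem_Iio.1 hx)]

/-- Integrating against a nonincreasing weight preserves an inequality between the integrals over
all initial intervals (layer cake). -/
theorem lintegral_mul_le_of_antitoneOn {c : ℝ≥0∞} {F G : ℝ → ℝ≥0∞} {L : ℝ} {ρ : ℝ → ℝ}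
    (hF : AEMeasurable F (volume.restrict (Ioo 0 L)))
    (hG : AEMeasurable G (volume.restrict (Ioo 0 L)))
    (hρ : AntitoneOn ρ (Ioo 0 L)) (hρ0 : ∀ y ∈ Ioo 0 L, 0 ≤ ρ y)
    (H : ∀ r, 0 < r → r ≤ L → c * ∫⁻ y in Ioo 0 r, F y ≤ ∫⁻ y in Ioo 0 r, G y) :
    c * ∫⁻ y in Ioo 0 L, F y * ENNReal.ofReal (ρ y)
      ≤ ∫⁻ y in Ioo 0 L, G y * ENNReal.ofReal (ρ y) := by
  have hρm : AEMeasurable ρ (volume.restrict (Ioo 0 L)) :=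
    aemeasurable_restrict_of_antitoneOn measurableSet_Ioo hρ
  have hρ0' : ∀ᵐ y ∂(volume.restrict (Ioo 0 L)), 0 ≤ ρ y :=
    (ae_restrict_iff' measurableSet_Ioo).2 (.of_forall hρ0)
  -- By monotonicity each superlevel set of `ρ` is an initial interval, up to its right endpoint
  -- `r`, which is a null set. An empty set corresponds to `r = 0`.
  have level : ∀ t : ℝ, ∃ r, 0 ≤ r ∧ (0 < r → r ≤ L) ∧
      {y | t < ρ y} =ᵐ[volume.restrict (Ioo 0 L)] Ioo 0 r := by
    intro t
    set S := Ioo 0 L ∩ {y | t < ρ y} with hS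
    suffices h : ∃ r, 0 ≤ r ∧ (0 < r → r ≤ L) ∧ Ioo 0 r ⊆ S ∧ S ⊆ Ioc 0 r by
      obtain ⟨r, h0, h1, h2, h3⟩ := h
      refine ⟨r, h0, h1, ?_⟩
      have hne : ∀ᵐ y : ℝ ∂(volume.restrict (Ioo 0 L)), y ≠ r :=
        ae_restrict_of_ae (Measure.ae_ne volume r)
      filter_upwards [hne, ae_restrict_mem measurableSet_Ioo] with y hy hyL
      refine propext ⟨fun h => ?_, fun h => (h2 h).2⟩
      have := h3 ⟨hyL, h⟩
      exact ⟨this.1, lt_of_le_of_ne this.2 hy⟩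
    rcases S.eq_empty_or_nonempty with h | h
    · exact ⟨0, le_rfl, fun h => absurd h (lt_irrefl _), by simp, by simp [h]⟩
    · have hbdd : BddAbove S := ⟨L, fun y hy => hy.1.2.le⟩
      obtain ⟨y, hy⟩ := h
      refine ⟨sSup S, hy.1.1.le.trans (le_csSup hbdd hy),
        fun _ => csSup_le ⟨y, hy⟩ fun y hy => hy.1.2.le, fun x hx => ?_,
        fun x hx => ⟨hx.1.1, le_csSup hbdd hx⟩⟩
      obtain ⟨z, hz, hxz⟩ := exists_lt_of_lt_csSup ⟨y, hy⟩ hx.2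
      have hxL : x ∈ Ioo 0 L := ⟨hx.1, hxz.trans hz.1.2⟩
      exact ⟨hxL, lt_of_lt_of_le hz.2 (hρ hxL hz.1 hxz.le)⟩
  have key : ∀ {F : ℝ → ℝ≥0∞}, AEMeasurable F (volume.restrict (Ioo 0 L)) →
      ∫⁻ y in Ioo 0 L, F y * ENNReal.ofReal (ρ y)
        = ∫⁻ t in Ioi 0, ((volume.restrict (Ioo 0 L)).withDensity F) {y | t < ρ y} := by
    intro F hF
    rw [← lintegral_eq_lintegral_meas_lt _
      ((withDensity_absolutelyContinuous _ F).ae_le hρ0')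
      (hρm.mono_ac (withDensity_absolutelyContinuous _ F)),
      lintegral_withDensity_eq_lintegral_mul₀ hF hρm.ennreal_ofReal]
    rfl
  have apply_level : ∀ {F : ℝ → ℝ≥0∞} {t r : ℝ}, (0 < r → r ≤ L) → 0 ≤ r →
      {y | t < ρ y} =ᵐ[volume.restrict (Ioo 0 L)] Ioo 0 r →
      ((volume.restrict (Ioo 0 L)).withDensity F) {y | t < ρ y} = ∫⁻ y in Ioo 0 r, F y := by
    intro F t r h1 h0 h2
    rw [measure_congr ((withDensity_absolutelyContinuous _ F).ae_eq h2),
      withDensity_apply _ measurableSet_Ioo, Measure.restrict_restrict measurableSet_Ioo,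
      inter_eq_left.2]
    rcases h0.eq_or_lt with rfl | h
    · simp
    · exact Ioo_subset_Ioo_right (h1 h)
  rw [key hF, key hG]
  refine (lintegral_const_mul_le _ _).trans (lintegral_mono fun t => ?_)
  obtain ⟨r, h0, h1, h2⟩ := level t
  simp only
  rw [apply_level h1 h0 h2, apply_level h1 h0 h2]
  rcases h0.eq_or_lt with rfl | h
  · simp
  · exact H r h (h1 h)

theorem modelDensity_eq_abs {K N D : ℝ} (hD : 0 < D) (x : ℝ) :
    modelDensity K N D x =
      (Iic (D / 2)).indicator (fun y => sFun (K / (N - 1)) (D / 2 + y) ^ (N - 1)) |x - D / 2| := by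
  rw [modelDensity_eq hD, indicator, indicator]
  congr 1
  rw [mem_Icc, mem_Iic, abs_le]
  exact propext ⟨fun h => ⟨by linarith [h.1], by linarith [h.2]⟩,
    fun h => ⟨by linarith [h.1], by linarith [h.2]⟩⟩

theorem isFiniteMeasure_densityMeasure {h : ℝ → ℝ} (hh : Integrable h volume) :
    IsFiniteMeasure (densityMeasure h) :=
  isFiniteMeasure_withDensity_ofReal hh.2

theorem integral_densityMeasure_eq_zero_of_odd {h g : ℝ → ℝ} (hh : AEMeasurable h volume)
    {c : ℝ} (hsymm : ∀ x, h (c - x) = h x) (hodd : ∀ x, g (c - x) = -g x) :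
    ∫ x, g x ∂(densityMeasure h) = 0 := by
  rw [densityMeasure, integral_withDensity_eq_integral_toReal_smul₀ hh.ennreal_ofReal (by simp)]
  have := integral_sub_left_eq_self (fun x => (ENNReal.ofReal (h x)).toReal • g x) volume c
  simp only [hsymm, hodd, smul_neg, integral_neg] at this
  linarith

theorem poincareConst_mul_le {h f : ℝ → ℝ} (hf : IsPoincareTest h f) :
    poincareConst h * ∫⁻ x, ENNReal.ofReal (f x ^ 2) ∂(densityMeasure h)
      ≤ ∫⁻ x, ENNReal.ofReal (|deriv f x| ^ 2) ∂(densityMeasure h) :=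
  (mul_le_mul_left (iInf₂_le f hf) _).trans
    (ENNReal.div_mul_cancel hf.sq_pos.ne' hf.sq_lt_top.ne).le

/-! ### Odd test functions on the model space. -/

/-- The odd extension about `c` of the function `f` on `[0, r]`, stopped at `r`; it is meant for
`f 0 = 0`. -/
def oddStopped (f : ℝ → ℝ) (c r x : ℝ) : ℝ :=
  f (max 0 (min (x - c) r)) - f (max 0 (min (-(x - c)) r))

section oddStopped

variable {f : ℝ → ℝ} {c r : ℝ}

theorem oddStopped_reflect (f : ℝ → ℝ) (c r x : ℝ) :
    oddStopped f c r (2 * c - x) = -oddStopped f c r x := by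
  unfold oddStopped
  rw [show 2 * c - x - c = -(x - c) by ring, neg_neg]
  ring

theorem locallyLipschitz_oddStopped (hf : LocallyLipschitz f) (c r : ℝ) :
    LocallyLipschitz (oddStopped f c r) := by
  have h1 : LipschitzWith 1 fun x : ℝ => x - c :=
    LipschitzWith.of_dist_le_mul fun x y => by simp
  have h2 : LipschitzWith 1 fun x : ℝ => -(x - c) :=
    LipschitzWith.of_dist_le_mul fun x y => by rw [dist_neg_neg]; simp
  exact (hf.comp ((h1.min_const r).const_max 0).locallyLipschitz).sub
    (hf.comp ((h2.min_const r).const_max 0).locallyLipschitz)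

theorem oddStopped_sq (hf0 : f 0 = 0) (hr : 0 ≤ r) (x : ℝ) :
    oddStopped f c r x ^ 2 = f (min |x - c| r) ^ 2 := by
  unfold oddStopped
  rcases le_total 0 (x - c) with h | h
  · rw [max_eq_right (le_min h hr), max_eq_left (min_le_of_left_le (by linarith)), hf0,
      abs_of_nonneg h, sub_zero]
  · rw [max_eq_left (min_le_of_left_le h), max_eq_right (le_min (by linarith) hr), hf0,
      abs_of_nonpos h, zero_sub, neg_sq]

theorem exists_abs_oddStopped_le (hf : Continuous f) (hr : 0 ≤ r) :
    ∃ C, ∀ x, |oddStopped f c r x| ≤ C := by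
  obtain ⟨C, hC⟩ := isCompact_Icc.exists_bound_of_continuousOn (s := Icc 0 r) hf.continuousOn
  refine ⟨C + C, fun x => (abs_sub _ _).trans (add_le_add (hC _ ?_) (hC _ ?_))⟩ <;>
  exact ⟨le_max_left _ _, max_le hr (min_le_right _ _)⟩

/-- Only the three points where the local formula changes are excluded. No differentiability of `f`
is needed, since translations and reflections transform `deriv` correctly even where it takes its
default value. -/
theorem abs_deriv_oddStopped (hr : 0 < r) {x : ℝ} (h0 : x ≠ c) (h1 : x ≠ c + r)
    (h2 : x ≠ c - r) :
    |deriv (oddStopped f c r) x| = (Iio r).indicator (fun y => |deriv f y|) |x - c| := by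
  rcases lt_or_gt_of_ne h0 with h | h
  · rw [abs_of_neg (sub_neg.2 h), neg_sub]
    rcases lt_or_gt_of_ne h2 with h' | h'
    · have : oddStopped f c r =ᶠ[nhds x] fun _ => f 0 - f r := by
        filter_upwards [Iio_mem_nhds h'] with y hy
        rw [mem_Iio] at hy
        unfold oddStopped
        rw [min_eq_left (by linarith), max_eq_left (by linarith), min_eq_right (by linarith),
          max_eq_right hr.le]
      rw [this.deriv_eq, deriv_const, abs_zero, indicator_of_notMem]
      rw [mem_Iio]
      linarith
    · have : oddStopped f c r =ᶠ[nhds x] fun y => f 0 - f (c - y) := by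
        filter_upwards [Ioo_mem_nhds h' h] with y hy
        rw [mem_Ioo] at hy
        unfold oddStopped
        rw [min_eq_left (by linarith), max_eq_left (by linarith), min_eq_left (by linarith),
          max_eq_right (by linarith), neg_sub]
      rw [this.deriv_eq, deriv_const_sub, deriv_comp_const_sub, neg_neg, indicator_of_mem]
      rw [mem_Iio]
      linarith
  · rw [abs_of_pos (sub_pos.2 h)]
    rcases lt_or_gt_of_ne h1 with h' | h'
    · have : oddStopped f c r =ᶠ[nhds x] fun y => f (y - c) - f 0 := by
        filter_upwards [Ioo_mem_nhds h h'] with y hy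
        rw [mem_Ioo] at hy
        unfold oddStopped
        rw [min_eq_left (by linarith), max_eq_right (by linarith), min_eq_left (by linarith),
          max_eq_left (by linarith)]
      rw [this.deriv_eq, deriv_sub_const, deriv_comp_sub_const, indicator_of_mem]
      rw [mem_Iio]
      linarith
    · have : oddStopped f c r =ᶠ[nhds x] fun _ => f r - f 0 := by
        filter_upwards [Ioi_mem_nhds h'] with y hy
        rw [mem_Ioi] at hy
        unfold oddStopped
        rw [min_eq_right (by linarith), max_eq_right hr.le, min_eq_left (by linarith),
          max_eq_left (by linarith)]
      rw [this.deriv_eq, deriv_const, abs_zero, indicator_of_notMem]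
      rw [mem_Iio]
      linarith

end oddStopped

/-- A weighted Poincaré inequality on `[0, r]`, for functions vanishing at `0`, with the Poincaré
constant of the model density. -/
theorem poincareConst_modelDensity_mul_le {K N D : ℝ} (hN : 1 < N) (hD : 0 < D) {f : ℝ → ℝ}
    (hf : LocallyLipschitz f) (hf0 : f 0 = 0) {r : ℝ} (hr : 0 < r) (hrD : r ≤ D / 2) :
    poincareConst (modelDensity K N D) * ∫⁻ y in Ioo 0 r,
        ENNReal.ofReal (f y ^ 2) * ENNReal.ofReal (sFun (K / (N - 1)) (D / 2 + y) ^ (N - 1))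
      ≤ ∫⁻ y in Ioo 0 r, ENNReal.ofReal (|deriv f y| ^ 2) *
        ENNReal.ofReal (sFun (K / (N - 1)) (D / 2 + y) ^ (N - 1)) := by
  set W : ℝ → ℝ := fun y => sFun (K / (N - 1)) (D / 2 + y) ^ (N - 1) with hW
  set g := oddStopped f (D / 2) r with hg
  have hint := integrable_modelDensity (K := K) hN hD
  have hgl : LocallyLipschitz g := locallyLipschitz_oddStopped hf _ _
  -- Only an inequality: the mass of the constant part beyond distance `r` from the centre is
  -- discarded.
  have hmass : 2 * ∫⁻ y in Ioo 0 r, ENNReal.ofReal (f y ^ 2) * ENNReal.ofReal (W y)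
      ≤ ∫⁻ x, ENNReal.ofReal (g x ^ 2) ∂(densityMeasure (modelDensity K N D)) := by
    rw [lintegral_densityMeasure hint.locallyIntegrable]
    have : ∀ x, ENNReal.ofReal (g x ^ 2) * ENNReal.ofReal (modelDensity K N D x) =
        (fun y => ENNReal.ofReal (f (min y r) ^ 2) *
          ENNReal.ofReal ((Iic (D / 2)).indicator W y)) |x - D / 2| := fun x => by
      rw [oddStopped_sq hf0 hr.le, modelDensity_eq_abs hD]
    rw [lintegral_congr this, lintegral_comp_abs_sub (fun y => ENNReal.ofReal (f (min y r) ^ 2) *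
      ENNReal.ofReal ((Iic (D / 2)).indicator W y)) (D / 2)]
    refine mul_le_mul_right ?_ _
    refine le_trans (le_of_eq ?_) (lintegral_mono_set
      (show Ioo 0 r ⊆ Ioi 0 from Ioo_subset_Ioi_self))
    refine setLIntegral_congr_fun measurableSet_Ioo fun y hy => ?_
    rw [min_eq_left hy.2.le, indicator_of_mem (mem_Iic.2 (hy.2.le.trans hrD))]
  have henergy : ∫⁻ x, ENNReal.ofReal (|deriv g x| ^ 2) ∂(densityMeasure (modelDensity K N D))
      = 2 * ∫⁻ y in Ioo 0 r, ENNReal.ofReal (|deriv f y| ^ 2) * ENNReal.ofReal (W y) := by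
    rw [lintegral_densityMeasure hint.locallyIntegrable]
    have : ∀ᵐ x : ℝ, ENNReal.ofReal (|deriv g x| ^ 2) * ENNReal.ofReal (modelDensity K N D x) =
        (fun y => (Iio r).indicator (fun y => ENNReal.ofReal (|deriv f y| ^ 2) *
          ENNReal.ofReal (W y)) y) |x - D / 2| := by
      filter_upwards [Measure.ae_ne volume (D / 2), Measure.ae_ne volume (D / 2 + r),
        Measure.ae_ne volume (D / 2 - r)] with x h0 h1 h2
      rw [abs_deriv_oddStopped hr h0 h1 h2, modelDensity_eq_abs hD]
      by_cases h : |x - D / 2| ∈ Iio r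
      · simp only [indicator_of_mem h,
          indicator_of_mem (mem_Iic.2 ((mem_Iio.1 h).le.trans hrD))]
        rfl
      · simp only [indicator_of_notMem h]
        simp
    rw [(lintegral_congr_ae this).trans (lintegral_comp_abs_sub _ _),
      setLIntegral_indicator measurableSet_Iio,
      inter_comm, Ioi_inter_Iio]
  -- If `g` has zero mass it is not an admissible test function, but then `hmass` makes the left
  -- side of the claim zero.
  rcases (zero_le (a := ∫⁻ x, ENNReal.ofReal (g x ^ 2)
    ∂(densityMeasure (modelDensity K N D)))).eq_or_lt
    with h0 | hpos
  · rw [← h0, nonpos_iff_eq_zero, mul_eq_zero, or_iff_right (by simp)] at hmass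
    rw [hmass, mul_zero]
    exact zero_le
  · have := isFiniteMeasure_densityMeasure hint
    obtain ⟨C, hC⟩ := exists_abs_oddStopped_le (c := D / 2) hf.continuous hr.le
    have htest : IsPoincareTest (modelDensity K N D) g :=
      { locallyLipschitz := hgl
        integrable := Integrable.of_bound hgl.continuous.aestronglyMeasurable C (.of_forall hC)
        mean_zero := by
          refine integral_densityMeasure_eq_zero_of_odd (c := D)
            (measurable_modelDensity hN hD).aemeasurable (fun x => ?_) fun x => ?_
          · rw [modelDensity_eq_abs hD, modelDensity_eq_abs hD, ← abs_neg]
            congr 2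
            ring
          · rw [hg, ← oddStopped_reflect]
            congr 1
            ring
        sq_pos := hpos
        sq_lt_top := by
          refine lt_of_le_of_lt (lintegral_mono (g := fun _ => ENNReal.ofReal (C ^ 2))
            fun x => ENNReal.ofReal_le_ofReal (sq_le_sq' ?_ ?_)) ?_
          · exact (abs_le.1 (hC x)).1
          · exact (abs_le.1 (hC x)).2
          · rw [lintegral_const]
            exact ENNReal.mul_lt_top ENNReal.ofReal_lt_top (measure_lt_top _ _) }
    have h2 := (mul_le_mul_right hmass _).trans ((poincareConst_mul_le htest).trans_eq henergy)
    rw [mul_left_comm] at h2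
    exact (ENNReal.mul_le_mul_iff_right (by simp) (by simp)).1 h2

/-! ### Support and monotonicity of MCP densities. -/

theorem sigmaCoeff_pos {K N t θ : ℝ} (hN : 1 < N) (ht : 0 < t) (ht1 : t ≤ 1) (hθ : 0 ≤ θ) :
    0 < sigmaCoeff K N t θ := by
  unfold sigmaCoeff
  split_ifs with h1 h2
  · simp
  · exact ENNReal.ofReal_pos.2 ht
  · rw [not_le] at h1
    have hθ' : 0 < θ := lt_of_le_of_ne hθ (Ne.symm h2)
    refine ENNReal.ofReal_pos.2 (div_pos (sFun_pos hN (mul_pos ht hθ')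
      (lt_of_le_of_lt (ENNReal.ofReal_le_ofReal ?_) h1)) (sFun_pos hN hθ' h1))
    exact mul_le_of_le_one_left hθ ht1

theorem exists_mem_supp_pos {h : ℝ → ℝ} (hh : LocallyIntegrable h volume) {x : ℝ}
    (hx : x ∈ supp h) {U : Set ℝ} (hU : U ∈ nhds x) : ∃ y ∈ supp h, y ∈ U ∧ 0 < h y := by
  by_contra! H
  have hpos := (Measure.mem_support_iff_forall x).1 hx U hU
  refine hpos.ne' (measure_mono_null (t := (supp h)ᶜ ∪ (supp h ∩ U)) (fun y hy => ?_)
    (measure_union_null Measure.measure_compl_support ?_))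
  · by_cases h' : y ∈ supp h
    · exact Or.inr ⟨h', hy⟩
    · exact Or.inl h'
  · rw [densityMeasure, withDensity_apply_eq_zero' (aemeasurable_ofReal_of_locallyIntegrable hh)]
    convert measure_empty (μ := (volume : Measure ℝ))
    refine eq_empty_of_forall_notMem ?_
    rintro y ⟨hy1, hy2, hy3⟩
    exact hy1 (ENNReal.ofReal_eq_zero.2 (H y hy2 hy3))

/-- The support of a nonzero `MCP(K,N)` density with bounded support is a nondegenerate interval,
of length at most the Bonnet–Myers diameter. -/
theorem IsMCPDensity.exists_supp_eq_Icc {K N : ℝ} {h : ℝ → ℝ} (hN : 1 < N)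
    (hh : IsMCPDensity K N h) (hne : densityMeasure h ≠ 0) (hb : Bornology.IsBounded (supp h)) :
    ∃ a b, a < b ∧ supp h = Icc a b ∧ ENNReal.ofReal (b - a) ≤ bonnetMyersDiam K N := by
  have hN' : 0 < N - 1 := by linarith
  have hc : IsCompact (supp h) :=
    Metric.isCompact_of_isClosed_isBounded Measure.isClosed_support hb
  have hn : (supp h).Nonempty := Measure.nonempty_support hne
  obtain ⟨a, ha⟩ := hc.exists_isLeast hn
  obtain ⟨b, hb⟩ := hc.exists_isGreatest hn
  have hsub : supp h ⊆ Icc a b := fun x hx => ⟨ha.2 hx, hb.2 hx⟩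
  have hab : a < b := by
    refine lt_of_le_of_ne (ha.2 hb.1) ?_
    rintro rfl
    rw [Icc_self] at hsub
    refine hne (Measure.measure_univ_eq_zero.1 ?_)
    rw [← union_compl_self (supp h)]
    refine measure_union_null (measure_mono_null hsub ?_) Measure.measure_compl_support
    exact withDensity_absolutelyContinuous _ _ (Real.volume_singleton)
  refine ⟨a, b, hab, hsub.antisymm fun x hx => ?_, ?_⟩
  · rcases hx.1.eq_or_lt with rfl | hax
    · exact ha.1
    -- The value `h a` may be zero, so the contraction towards `b` starts from a nearby `y` with `h
    -- y > 0`; it gives positivity on `(y, b)`.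
    obtain ⟨y, hy, hyx, hpos⟩ := exists_mem_supp_pos hh.locallyIntegrable ha.1
      (Iio_mem_nhds hax)
    rw [mem_Iio] at hyx
    have hyb : y < b := hyx.trans_le hx.2
    refine Icc_subset_supp hyb hh.locallyIntegrable (fun z hz => ?_) ⟨hyx.le, hx.2⟩
    have hyb' : 0 < b - y := by linarith
    have ht : (z - y) / (b - y) < 1 := by
      rw [div_lt_one hyb']
      linarith [hz.2]
    have ht0 : 0 ≤ (z - y) / (b - y) := div_nonneg (by linarith [hz.1]) hyb'.le
    have := hh.contraction y hy b hb.1 ((z - y) / (b - y)) ⟨ht0, ht.le⟩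
    rw [show (z - y) / (b - y) * b + (1 - (z - y) / (b - y)) * y = z by field_simp; ring] at this
    refine ENNReal.ofReal_pos.1 (lt_of_lt_of_le ?_ this)
    exact ENNReal.mul_pos (ENNReal.rpow_pos_of_nonneg (sigmaCoeff_pos hN (by linarith)
      (by linarith) (abs_nonneg _)) hN'.le).ne' (ENNReal.ofReal_pos.2 hpos).ne'
  · by_contra! H
    have hU : {x | bonnetMyersDiam K N < ENNReal.ofReal (b - x)} ∈ nhds a :=
      (isOpen_lt continuous_const
        (ENNReal.continuous_ofReal.comp (continuous_const.sub continuous_id))).mem_nhds H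
    obtain ⟨y, hy, hyx, hpos⟩ := exists_mem_supp_pos hh.locallyIntegrable ha.1 hU
    -- At `t = 0` the contraction inequality reads `∞ · h y ≤ h y`, impossible for `0 < h y < ∞`.
    have := hh.contraction y hy b hb.1 0 ⟨le_rfl, zero_le_one⟩
    rw [sigmaCoeff, if_pos, ENNReal.top_rpow_of_pos hN', ENNReal.top_mul, top_le_iff] at this
    · exact ENNReal.ofReal_ne_top this
    · exact (ENNReal.ofReal_pos.2 hpos).ne'
    · rw [abs_of_nonneg (by linarith [hb.2 hy])]
      rw [mem_ofPred_eq] at hyx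
      exact hyx.le

/-- Contraction towards a point `e` of the support, in the affine coordinate `e + c u`. -/
theorem IsMCPDensity.mul_le {K N : ℝ} {h : ℝ → ℝ} (hN : 1 < N) (hh : IsMCPDensity K N h)
    {e c u v : ℝ} (he : e ∈ supp h) (hc : c ≠ 0) (hu : 0 < u) (huv : u ≤ v)
    (hv : e + c * v ∈ supp h) (hvK : ENNReal.ofReal (|c| * v) < bonnetMyersDiam K N) :
    sFun (K / (N - 1)) (|c| * u) ^ (N - 1) * h (e + c * v)
      ≤ sFun (K / (N - 1)) (|c| * v) ^ (N - 1) * h (e + c * u) := by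
  have hN' : 0 < N - 1 := by linarith
  have hv0 : 0 < v := hu.trans_le huv
  have hcpos : 0 < |c| := abs_pos.2 hc
  have hsv := sFun_pos hN (mul_pos hcpos hv0) hvK
  have hsu := sFun_pos (K := K) hN (mul_pos hcpos hu) (lt_of_le_of_lt (ENNReal.ofReal_le_ofReal
    (mul_le_mul_of_nonneg_left huv hcpos.le)) hvK)
  have ht : u / v ≤ 1 := (div_le_one hv0).2 huv
  have := hh.contraction _ hv e he (1 - u / v) ⟨by linarith, by linarith [div_pos hu hv0]⟩
  rw [show |e - (e + c * v)| = |c| * v by rw [sub_add_cancel_left, abs_neg, abs_mul,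
      abs_of_pos hv0],
    show (1 - u / v) * e + (1 - (1 - u / v)) * (e + c * v) = e + c * u by field_simp; ring,
    sub_sub_cancel, sigmaCoeff, if_neg hvK.not_ge, if_neg (mul_pos hcpos hv0).ne',
    show u / v * (|c| * v) = |c| * u by field_simp,
    ENNReal.ofReal_rpow_of_nonneg (div_pos hsu hsv).le hN'.le,
    ← ENNReal.ofReal_mul (by positivity), ENNReal.ofReal_le_ofReal_iff (hh.nonneg _),
    Real.div_rpow hsu.le hsv.le, div_mul_eq_mul_div, div_le_iff₀' (by positivity)] at this
  exact this

/-- The quotient is the product of `h(e + cu) / s(|c|u)^(N-1)`, nonincreasing by contraction towards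
`e`, and `(s(|c|u) / s(u))^(N-1)`, which is constant if `|c| = 1` and nonincreasing if `K ≤ 0`. The
factor `|c|` is the ratio between the length of the support and that of the model. -/
theorem IsMCPDensity.antitoneOn_div {K N : ℝ} {h : ℝ → ℝ} (hN : 1 < N)
    (hh : IsMCPDensity K N h) {e c D : ℝ} (he : e ∈ supp h) (hc : c ≠ 0) (hc1 : |c| ≤ 1)
    (hcK : |c| = 1 ∨ K ≤ 0) (hDK : ENNReal.ofReal D ≤ bonnetMyersDiam K N)
    (hsupp : ∀ u ∈ Ioo 0 D, e + c * u ∈ supp h) :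
    AntitoneOn (fun u => h (e + c * u) / sFun (K / (N - 1)) u ^ (N - 1)) (Ioo 0 D) := by
  intro u hu v hv huv
  have hN' : 0 < N - 1 := by linarith
  have hcpos : 0 < |c| := abs_pos.2 hc
  have hlt : ∀ w ∈ Ioo 0 D, ENNReal.ofReal w < bonnetMyersDiam K N := fun w hw =>
    lt_of_lt_of_le ((ENNReal.ofReal_lt_ofReal_iff (hw.1.trans hw.2)).2 hw.2) hDK
  have hlt' : ∀ w ∈ Ioo 0 D, ENNReal.ofReal (|c| * w) < bonnetMyersDiam K N := fun w hw =>
    (ENNReal.ofReal_le_ofReal (mul_le_of_le_one_left hw.1.le hc1)).trans_lt (hlt w hw)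
  have hsu := sFun_pos hN hu.1 (hlt u hu)
  have hsv := sFun_pos hN hv.1 (hlt v hv)
  have hscu := sFun_pos hN (mul_pos hcpos hu.1) (hlt' u hu)
  have hscv := sFun_pos hN (mul_pos hcpos hv.1) (hlt' v hv)
  have hratio : sFun (K / (N - 1)) (|c| * v) * sFun (K / (N - 1)) u
      ≤ sFun (K / (N - 1)) (|c| * u) * sFun (K / (N - 1)) v := by
    rcases hcK with h1 | hK
    · rw [h1, one_mul, one_mul, mul_comm]
    · exact sFun_mul_mul_sFun_le (div_nonpos_of_nonpos_of_nonneg hK hN'.le) hcpos hc1 hu.1 huv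
  have hratio' := Real.rpow_le_rpow (by positivity) hratio hN'.le
  rw [Real.mul_rpow hscv.le hsu.le, Real.mul_rpow hscu.le hsv.le] at hratio'
  have hcon := hh.mul_le hN he hc hu.1 huv (hsupp v hv) (hlt' v hv)
  simp only
  rw [div_le_div_iff₀ (by positivity) (by positivity)]
  have hp : 0 < sFun (K / (N - 1)) (|c| * v) ^ (N - 1) := by positivity
  refine le_of_mul_le_mul_left ?_ hp
  have h1 := mul_le_mul_of_nonneg_right hratio' (hh.nonneg (e + c * v))
  have h2 := mul_le_mul_of_nonneg_right hcon
    (Real.rpow_nonneg hsv.le (N - 1))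
  linarith

/-! ### Comparison with the model. -/

/-- The Poincaré inequality on one half of the support, for functions vanishing at the midpoint. -/
theorem IsMCPDensity.poincareConst_mul_le_half {K N : ℝ} {h : ℝ → ℝ} (hN : 1 < N)
    (hh : IsMCPDensity K N h) {e c D m : ℝ} (hD : 0 < D) (he : e ∈ supp h) (hc : c ≠ 0)
    (hc1 : |c| ≤ 1) (hcK : |c| = 1 ∨ K ≤ 0) (hDK : ENNReal.ofReal D ≤ bonnetMyersDiam K N)
    (hsupp : ∀ u ∈ Ioo 0 D, e + c * u ∈ supp h) (hm : m = e + c * (D / 2)) {f : ℝ → ℝ}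
    (hf : LocallyLipschitz f) :
    poincareConst (modelDensity K N D) *
        ∫⁻ x in (fun y => m + c * y) '' Ioo 0 (D / 2),
          ENNReal.ofReal ((f x - f m) ^ 2) * ENNReal.ofReal (h x)
      ≤ ∫⁻ x in (fun y => m + c * y) '' Ioo 0 (D / 2),
          ENNReal.ofReal (|deriv f x| ^ 2) * ENNReal.ofReal (h x) := by
  set g : ℝ → ℝ := fun y => f (m + c * y) - f m with hg
  set W : ℝ → ℝ := fun y => sFun (K / (N - 1)) (D / 2 + y) ^ (N - 1) with hW
  have haff : LipschitzWith (Real.nnabs c) fun y : ℝ => m + c * y :=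
    LipschitzWith.of_dist_le_mul fun x y => by
      rw [dist_add_left, Real.dist_eq, Real.dist_eq, ← mul_sub, abs_mul, Real.coe_nnabs]
  have hgl : LocallyLipschitz g := (hf.comp haff.locallyLipschitz).sub (LocallyLipschitz.const _)
  have hg' : ∀ y, deriv g y = c * deriv f (m + c * y) := fun y => by
    rw [hg, deriv_sub_const, deriv_comp_mul_left c (fun z => f (m + z)), deriv_comp_const_add,
      smul_eq_mul]
  have hWm : Measurable W :=
    (Continuous.rpow_const ((continuous_sFun _).comp (by fun_prop))
      fun _ => Or.inr (by linarith)).measurable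
  have hshift : ∀ y ∈ Ioo 0 (D / 2), D / 2 + y ∈ Ioo 0 D := fun y hy =>
    ⟨by linarith [hy.1], by linarith [hy.2]⟩
  have hWpos : ∀ y ∈ Ioo 0 (D / 2), 0 < W y := fun y hy =>
    Real.rpow_pos_of_pos (sFun_pos hN (hshift y hy).1 (lt_of_lt_of_le
      ((ENNReal.ofReal_lt_ofReal_iff hD).2 (hshift y hy).2) hDK)) _
  have hpt : ∀ y, e + c * (D / 2 + y) = m + c * y := fun y => by rw [hm]; ring
  have hanti : AntitoneOn (fun y => h (m + c * y) / W y) (Ioo 0 (D / 2)) := by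
    intro y hy z hz hyz
    have := hh.antitoneOn_div hN he hc hc1 hcK hDK hsupp (hshift y hy) (hshift z hz)
      (by linarith)
    simpa only [hpt] using this
  -- Write `h = W · (h / W)` along the half: `W` is the model weight, `h / W` the nonincreasing
  -- factor.
  have key := lintegral_mul_le_of_antitoneOn (c := poincareConst (modelDensity K N D))
    (F := fun y => ENNReal.ofReal (g y ^ 2) * ENNReal.ofReal (W y))
    (G := fun y => ENNReal.ofReal (|deriv g y| ^ 2) * ENNReal.ofReal (W y))
    (((hgl.continuous.measurable.pow_const 2).ennreal_ofReal.mul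
      hWm.ennreal_ofReal).aemeasurable)
    ((((measurable_deriv g).abs.pow_const 2).ennreal_ofReal.mul
      hWm.ennreal_ofReal).aemeasurable) hanti
    (fun y hy => div_nonneg (hh.nonneg _) (hWpos y hy).le)
    (fun r hr hrD => poincareConst_modelDensity_mul_le hN hD hgl (by simp [hg]) hr hrD)
  have hcancel : ∀ y ∈ Ioo 0 (D / 2), ∀ A : ℝ≥0∞,
      A * ENNReal.ofReal (W y) * ENNReal.ofReal (h (m + c * y) / W y)
        = A * ENNReal.ofReal (h (m + c * y)) := fun y hy A => by
    rw [mul_assoc, ← ENNReal.ofReal_mul (hWpos y hy).le, mul_div_cancel₀ _ (hWpos y hy).ne']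
  rw [setLIntegral_congr_fun measurableSet_Ioo fun y hy => hcancel y hy _,
    setLIntegral_congr_fun measurableSet_Ioo fun y hy => hcancel y hy _] at key
  have hchange := fun G => lintegral_image_eq_lintegral_abs_deriv_mul (f := fun y => m + c * y)
    (f' := fun _ => c) (s := Ioo 0 (D / 2)) measurableSet_Ioo
    (fun y _ => by
      simpa using (((hasDerivAt_id y).const_mul c).const_add m).hasDerivWithinAt)
    (fun y _ z _ hyz => mul_left_cancel₀ hc (add_left_cancel hyz)) G
  rw [hchange, hchange, lintegral_const_mul' _ _ ENNReal.ofReal_ne_top,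
    lintegral_const_mul' _ _ ENNReal.ofReal_ne_top, mul_left_comm]
  refine mul_le_mul_right (key.trans (lintegral_mono fun y => ?_)) _
  refine mul_le_mul_left (ENNReal.ofReal_le_ofReal ?_) _
  -- The chain rule contributes `|c| ^ 2 ≤ 1`, so stretching to the model's length only helps.
  rw [hg', abs_mul, mul_pow]
  exact mul_le_of_le_one_left (by positivity) (pow_le_one₀ (abs_nonneg _) hc1)

theorem image_add_mul_Ioo {m c L : ℝ} (hc : 0 < c) :
    (fun y => m + c * y) '' Ioo 0 L = Ioo m (m + c * L) := by
  ext x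
  refine ⟨?_, fun hx => ⟨(x - m) / c, ⟨div_pos (by linarith [hx.1]) hc, ?_⟩, ?_⟩⟩
  · rintro ⟨y, hy, rfl⟩
    exact ⟨by nlinarith [hy.1], by nlinarith [hy.2]⟩
  · rw [div_lt_iff₀' hc]
    linarith [hx.2]
  · simp only
    field_simp
    ring

theorem image_sub_mul_Ioo {m c L : ℝ} (hc : 0 < c) :
    (fun y => m + -c * y) '' Ioo 0 L = Ioo (m - c * L) m := by
  ext x
  refine ⟨?_, fun hx => ⟨(m - x) / c, ⟨div_pos (by linarith [hx.2]) hc, ?_⟩, ?_⟩⟩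
  · rintro ⟨y, hy, rfl⟩
    exact ⟨by nlinarith [hy.2], by nlinarith [hy.1]⟩
  · rw [div_lt_iff₀' hc]
    linarith [hx.1]
  · simp only
    field_simp
    ring

/-- For a mean-zero function, the second moment is smallest about `0`. -/
theorem IsPoincareTest.lintegral_sq_le {h f : ℝ → ℝ} [IsFiniteMeasure (densityMeasure h)]
    (hf : IsPoincareTest h f) (c : ℝ) :
    ∫⁻ x, ENNReal.ofReal (f x ^ 2) ∂(densityMeasure h)
      ≤ ∫⁻ x, ENNReal.ofReal ((f x - c) ^ 2) ∂(densityMeasure h) := by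
  have hsq : Integrable (fun x => f x ^ 2) (densityMeasure h) :=
    ⟨(hf.locallyLipschitz.continuous.pow 2).aestronglyMeasurable,
      (hasFiniteIntegral_iff_ofReal (.of_forall fun x => sq_nonneg _)).2 hf.sq_lt_top⟩
  have hexp : (fun x => (f x - c) ^ 2) = fun x => f x ^ 2 - 2 * c * f x + c ^ 2 := by
    funext x
    ring
  have hlin : Integrable (fun x => f x ^ 2 - 2 * c * f x) (densityMeasure h) :=
    hsq.sub (hf.integrable.const_mul _)
  have hsq' : Integrable (fun x => (f x - c) ^ 2) (densityMeasure h) := by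
    rw [hexp]
    exact hlin.add (integrable_const _)
  rw [← ofReal_integral_eq_lintegral_ofReal hsq (.of_forall fun x => sq_nonneg _),
    ← ofReal_integral_eq_lintegral_ofReal hsq' (.of_forall fun x => sq_nonneg _)]
  refine ENNReal.ofReal_le_ofReal ?_
  rw [hexp, integral_add hlin (integrable_const _), integral_sub hsq (hf.integrable.const_mul _),
    integral_const_mul, hf.mean_zero, integral_const, smul_eq_mul, mul_zero, sub_zero]
  exact le_add_of_nonneg_right (by positivity)

/-- Comparison of the Poincaré constant of an `MCP(K,N)` density supported on `[a, b]` with that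
of the model density on `[0, D]`. -/
theorem IsMCPDensity.poincareConst_modelDensity_le {K N : ℝ} {h : ℝ → ℝ} (hN : 1 < N)
    (hh : IsMCPDensity K N h) {a b D : ℝ} (hab : a < b) (hsupp : supp h = Icc a b)
    (hD : b - a ≤ D) (hDK : ENNReal.ofReal D ≤ bonnetMyersDiam K N) (hK : b - a = D ∨ K ≤ 0) :
    poincareConst (modelDensity K N D) ≤ poincareConst h := by
  have hba : 0 < b - a := by linarith
  have hD0 : 0 < D := hba.trans_le hD
  set k := (b - a) / D with hk
  have hk0 : 0 < k := div_pos hba hD0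
  have hk1 : k ≤ 1 := (div_le_one hD0).2 hD
  have hkD : k * D = b - a := div_mul_cancel₀ _ hD0.ne'
  have hkK : k = 1 ∨ K ≤ 0 := hK.imp_left fun h => by rw [hk, h, div_self hD0.ne']
  set m := (a + b) / 2 with hm
  have hnull : ∀ x, densityMeasure h {x} = 0 := fun x =>
    withDensity_absolutelyContinuous _ _ Real.volume_singleton
  have hmem : ∀ᵐ x ∂(densityMeasure h), x ∈ Ioo a m ∪ Ioo m b := by
    have hs : ∀ᵐ x ∂(densityMeasure h), x ∈ supp h := Measure.support_mem_ae
    filter_upwards [hs, measure_eq_zero_iff_ae_notMem.1 (hnull a),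
      measure_eq_zero_iff_ae_notMem.1 (hnull b), measure_eq_zero_iff_ae_notMem.1 (hnull m)]
      with x hx hxa hxb hxm
    rw [hsupp] at hx
    rcases lt_or_gt_of_ne (show x ≠ m from hxm) with h | h
    · exact Or.inl ⟨lt_of_le_of_ne hx.1 (Ne.symm hxa), h⟩
    · exact Or.inr ⟨h, lt_of_le_of_ne hx.2 hxb⟩
  have hsplit : ∀ G : ℝ → ℝ≥0∞, ∫⁻ x, G x ∂(densityMeasure h)
      = (∫⁻ x in Ioo a m, G x * ENNReal.ofReal (h x))
        + ∫⁻ x in Ioo m b, G x * ENNReal.ofReal (h x) := by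
    intro G
    have hset : ∀ s, MeasurableSet s → ∫⁻ x in s, G x ∂(densityMeasure h)
        = ∫⁻ x in s, G x * ENNReal.ofReal (h x) := fun s hs => by
      rw [densityMeasure, restrict_withDensity hs,
        lintegral_withDensity_eq_lintegral_mul_non_measurable₀ _
          (aemeasurable_ofReal_of_locallyIntegrable hh.locallyIntegrable).restrict (by simp)]
      simp only [Pi.mul_apply, mul_comm]
    rw [← hset _ measurableSet_Ioo, ← hset _ measurableSet_Ioo, ← lintegral_union
      measurableSet_Ioo (disjoint_left.2 fun x h1 h2 => lt_asymm h1.2 h2.1),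
      Measure.restrict_eq_self_of_ae_mem hmem]
  have hfin : IsFiniteMeasure (densityMeasure h) := by
    refine ⟨?_⟩
    rw [← measure_add_measure_compl (measurableSet_Icc (a := a) (b := b)), ← hsupp,
      show densityMeasure h (supp h)ᶜ = 0 from Measure.measure_compl_support, add_zero, hsupp,
      densityMeasure, withDensity_apply _ measurableSet_Icc]
    exact (hasFiniteIntegral_iff_ofReal (.of_forall hh.nonneg)).1
      (hh.locallyIntegrable.integrableOn_isCompact isCompact_Icc).2
  refine le_iInf₂ fun f hf => ?_
  rw [ENNReal.le_div_iff_mul_le (Or.inl hf.sq_pos.ne') (Or.inl hf.sq_lt_top.ne)]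
  refine (mul_le_mul_right (hf.lintegral_sq_le (f m)) _).trans ?_
  rw [hsplit, hsplit, mul_add]
  refine add_le_add ?_ ?_
  -- For the left half the contraction is towards the far endpoint `b`, and the distance from `b`
  -- grows from `m` to `a`; the right half uses `a`.
  · have := hh.poincareConst_mul_le_half hN (e := b) (c := -k) (m := m) hD0
      (hsupp ▸ right_mem_Icc.2 hab.le) (neg_ne_zero.2 hk0.ne')
      (by rwa [abs_neg, abs_of_pos hk0]) (by rwa [abs_neg, abs_of_pos hk0]) hDK
      (fun u hu => by rw [hsupp]; exact ⟨by nlinarith [hu.2], by nlinarith [hu.1]⟩) (by linarith)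
      hf.locallyLipschitz
    rwa [image_sub_mul_Ioo hk0, show m - k * (D / 2) = a by linarith] at this
  · have := hh.poincareConst_mul_le_half hN (e := a) (c := k) (m := m) hD0
      (hsupp ▸ left_mem_Icc.2 hab.le) hk0.ne'
      (by rwa [abs_of_pos hk0]) (by rwa [abs_of_pos hk0]) hDK
      (fun u hu => by rw [hsupp]; exact ⟨by nlinarith [hu.1], by nlinarith [hu.2]⟩) (by linarith)
      hf.locallyLipschitz
    rwa [image_add_mul_Ioo hk0, show m + k * (D / 2) = b by linarith] at this

theorem IsMCPDensity.poincareBound_le {K N D : ℝ} {h : ℝ → ℝ} (hN : 1 < N) (hD : 0 < D)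
    (hh : IsMCPDensity K N h) (hdiam : Metric.ediam (supp h) ≤ ENNReal.ofReal D) :
    poincareBound K N D ≤ poincareConst h := by
  -- The zero density has no test functions, so its Poincaré constant is `∞`.
  by_cases hne : densityMeasure h = 0
  · refine le_iInf₂ fun f hf => ?_
    have := hf.sq_pos
    simp [hne] at this
  obtain ⟨a, b, hab, hsupp, hbK⟩ := hh.exists_supp_eq_Icc hN hne
    (Metric.isBounded_iff_ediam_ne_top.2 (ne_top_of_le_ne_top ENNReal.ofReal_ne_top hdiam))
  rw [hsupp, Real.ediam_Icc, ENNReal.ofReal_le_ofReal_iff hD.le] at hdiam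
  unfold poincareBound
  split_ifs with hK
  · exact hh.poincareConst_modelDensity_le hN hab hsupp hdiam
      (by rw [bonnetMyersDiam_of_nonpos hK]; exact le_top) (Or.inr hK)
  -- For `K > 0` there is no stretching: the model of the same length as the support is used.
  · have hmem : b - a ∈ admissibleDiams K N D := ⟨sub_pos.2 hab, hdiam, hbK⟩
    exact (sInf_le (mem_image_of_mem _ hmem)).trans
      (hh.poincareConst_modelDensity_le hN hab hsupp le_rfl hbK (Or.inl rfl))

theorem modelDensity_mem_densitiesDiamLE {K N D D' : ℝ} (hN : 1 < N)
    (hD' : D' ∈ admissibleDiams K N D) : modelDensity K N D' ∈ densitiesDiamLE K N D := by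
  refine ⟨isMCPDensity_modelDensity hN hD'.1 hD'.2.2, ?_⟩
  rw [supp_modelDensity hN hD'.1 hD'.2.2, Real.ediam_Icc, sub_zero]
  exact ENNReal.ofReal_le_ofReal hD'.2.1

theorem self_mem_admissibleDiams {K N D : ℝ} (hD : 0 < D) (hK : K ≤ 0) :
    D ∈ admissibleDiams K N D :=
  ⟨hD, le_rfl, by rw [bonnetMyersDiam_of_nonpos hK]; exact le_top⟩

end MCP

theorem corollary4p7 (K N D : ℝ) (hN : 1 < N) (hD : 0 < D) :
    (∀ h : ℝ → ℝ, MCP.IsMCPDensity K N h → Metric.ediam (MCP.supp h) ≤ ENNReal.ofReal D →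
      MCP.poincareBound K N D ≤ MCP.poincareConst h) ∧
    (∀ D' ∈ MCP.admissibleDiams K N D,
      MCP.IsMCPDensity K N (MCP.modelDensity K N D') ∧
        MCP.supp (MCP.modelDensity K N D') = Set.Icc 0 D') ∧
    IsGLB (MCP.poincareConst '' MCP.densitiesDiamLE K N D) (MCP.poincareBound K N D) ∧
    (K ≤ 0 → ∃ h ∈ MCP.densitiesDiamLE K N D,
      MCP.poincareConst h = MCP.poincareBound K N D) := by
  refine ⟨fun h hh hd => hh.poincareBound_le hN hD hd,
    fun D' hD' => ⟨MCP.isMCPDensity_modelDensity hN hD'.1 hD'.2.2,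
      MCP.supp_modelDensity hN hD'.1 hD'.2.2⟩, ⟨?_, fun l hl => ?_⟩,
    fun hK => ⟨_, MCP.modelDensity_mem_densitiesDiamLE hN (MCP.self_mem_admissibleDiams hD hK),
      (if_pos hK).symm⟩⟩
  · rintro _ ⟨h, ⟨hh, hd⟩, rfl⟩
    exact hh.poincareBound_le hN hD hd
  · unfold MCP.poincareBound
    split_ifs with hK
    · exact hl (Set.mem_image_of_mem _ (MCP.modelDensity_mem_densitiesDiamLE hN
        (MCP.self_mem_admissibleDiams hD hK)))
    · refine le_sInf ?_
      rintro _ ⟨D', hD', rfl⟩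
      exact hl (Set.mem_image_of_mem _ (MCP.modelDensity_mem_densitiesDiamLE hN hD'))
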